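/- For $\sigma,\tau$ in the symmetric group $S_n$ let $d_{\mathrm{hamm}}(\sigma,\tau)=\frac1n|\{i:\sigma(i)\neq\tau(i)\}|$ be the normalized Hamming distance (with $d_{\mathrm{hamm}}=0$ on the trivial group $S_0$). A group $G$ is called sofic if there are a set $A$, an ultrafilter $\mathcal U$ on $A$ and natural numbers $n(\alpha)$, $\alpha\in A$, such that $G$ is isomorphic to a subgroup of the metric ultraproduct $$\Bigl(\prod_{\alpha\in A}S_{n(\alpha)}\Bigr)\Big/\Bigl\{(\sigma_\alpha)_{\alpha\in A}:\lim_{\alpha\to\mathcal U}d_{\mathrm{hamm}}(\sigma_\alpha,\mathrm{Id})=0\Bigr\}.$$ A group is called minimal non-sofic if it is not sofic but every proper subgroup of it is sofic. A (discrete) group $Q$ is called amenable if for every finite $S\subseteq Q$ and every $\varepsilon>0$ there is a nonempty finite $K\subseteq Q$ with $|gK\,\triangle\,K|\le\varepsilon|K|$ for all $g\in S$. A maximal normal subgroup is a maximal element, with respect to inclusion, of the set of proper normal subgroups. Proposition. Let $G$ be a minimal non-sofic group. Then the following hold: 1. $G$ is finitely generated. In particular, $G$ has a maximal subgroup (a maximal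 element of the set of proper subgroups). 2. $G$ has no nontrivial amenable quotient: if $N\trianglelefteq G$ and $G/N$ is nontrivial, then $G/N$ is not amenable. In particular, $G$ is perfect, that is, $G=[G,G]$. 3. $G$ has a maximal normal subgroup. -/

import Mathlib

universe u

/-- The normalized Hamming distance `|{i | σ i ≠ τ i}| / n` on the symmetric group `S_n`
(equal to `0` on the one-element group `S_0`). -/
noncomputable def normHammingDist {n : ℕ} (σ τ : Equiv.Perm (Fin n)) : ℝ :=
  (hammingDist (σ : Fin n → Fin n) (τ : Fin n → Fin n) : ℝ) / n

theorem normHammingDist_nonneg {n : ℕ} (σ τ : Equiv.Perm (Fin n)) :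
    0 ≤ normHammingDist σ τ := by
  unfold normHammingDist
  positivity

theorem normHammingDist_self {n : ℕ} (σ : Equiv.Perm (Fin n)) : normHammingDist σ σ = 0 := by
  simp [normHammingDist]

theorem normHammingDist_comm {n : ℕ} (σ τ : Equiv.Perm (Fin n)) :
    normHammingDist σ τ = normHammingDist τ σ := by
  simp only [normHammingDist, hammingDist_comm]

theorem normHammingDist_triangle {n : ℕ} (σ τ ρ : Equiv.Perm (Fin n)) :
    normHammingDist σ ρ ≤ normHammingDist σ τ + normHammingDist τ ρ := by
  unfold normHammingDist
  rw [← add_div]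
  gcongr
  exact_mod_cast hammingDist_triangle _ _ _

theorem normHammingDist_mul_left {n : ℕ} (ρ σ τ : Equiv.Perm (Fin n)) :
    normHammingDist (ρ * σ) (ρ * τ) = normHammingDist σ τ := by
  simp [normHammingDist, hammingDist]

theorem normHammingDist_mul_right {n : ℕ} (σ τ ρ : Equiv.Perm (Fin n)) :
    normHammingDist (σ * ρ) (τ * ρ) = normHammingDist σ τ := by
  unfold normHammingDist hammingDist
  congr 2
  refine Finset.card_bij (fun i _ => ρ i) ?_ ?_ ?_
  · intro i hi
    exact Finset.mem_filter.2 ⟨Finset.mem_univ _, (Finset.mem_filter.1 hi).2⟩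
  · intro i _ j _ h
    exact ρ.injective h
  · intro j hj
    refine ⟨ρ.symm j, Finset.mem_filter.2 ⟨Finset.mem_univ _, ?_⟩, by simp⟩
    simpa using (Finset.mem_filter.1 hj).2

/-- The normal subgroup of `∏ a, S_{n a}` consisting of the families whose normalized Hamming
distance to the identity tends to `0` along the ultrafilter `U`. -/
noncomputable def ultraNull {A : Type u} (U : Ultrafilter A) (n : A → ℕ) :
    Subgroup ((a : A) → Equiv.Perm (Fin (n a))) where
  carrier := {σ | Filter.Tendsto (fun a => normHammingDist (σ a) 1) U (nhds 0)}
  one_mem' := by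
    simp [normHammingDist_self]
  mul_mem' := by
    intro σ τ hσ hτ
    refine squeeze_zero (fun a => normHammingDist_nonneg _ _) (fun a => ?_)
      (by simpa using Filter.Tendsto.add hσ hτ)
    calc normHammingDist (σ a * τ a) 1
        ≤ normHammingDist (σ a * τ a) (σ a * 1) + normHammingDist (σ a * 1) 1 :=
          normHammingDist_triangle _ _ _
      _ = normHammingDist (σ a) 1 + normHammingDist (τ a) 1 := by
          rw [normHammingDist_mul_left, mul_one, add_comm]
  inv_mem' := by
    intro σ hσ
    refine Filter.Tendsto.congr (fun a => ?_) hσ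
    rw [← normHammingDist_mul_left (σ⁻¹ a) (σ a) 1, normHammingDist_comm]
    simp

instance ultraNull_normal {A : Type u} (U : Ultrafilter A) (n : A → ℕ) :
    (ultraNull U n).Normal where
  conj_mem := by
    intro σ hσ τ
    refine Filter.Tendsto.congr (fun a => ?_) hσ
    rw [← normHammingDist_mul_left (τ a) (σ a) 1,
      ← normHammingDist_mul_right (τ a * σ a) (τ a * 1) (τ a)⁻¹]
    simp

/-- The metric ultraproduct `(∏ a, (S_{n a}, d_Hamm)) / U` of finite symmetric groups. -/
abbrev MetricUltraproduct {A : Type u} (U : Ultrafilter A) (n : A → ℕ) : Type u :=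
  ((a : A) → Equiv.Perm (Fin (n a))) ⧸ ultraNull U n

/-- A group is sofic if it is isomorphic to a subgroup of a metric ultraproduct of finite
symmetric groups equipped with the normalized Hamming distances. -/
def IsSofic (G : Type u) [Group G] : Prop :=
  ∃ (A : Type u) (U : Ultrafilter A) (n : A → ℕ) (f : G →* MetricUltraproduct U n),
    Function.Injective f

/-- A group is minimal non-sofic if it is not sofic but all its proper subgroups are. -/
structure IsMinimalNonSofic (G : Type u) [Group G] : Prop where
  not_isSofic : ¬ IsSofic G
  isSofic_of_ne_top : ∀ H : Subgroup G, H ≠ ⊤ → IsSofic H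

open Classical in
/-- A discrete group is amenable (Følner's condition) if for every finite set `S` of elements and
every `ε > 0` there is a nonempty finite set `K` with `|gK ∆ K| ≤ ε |K|` for all `g ∈ S`. -/
def IsAmenableGroup (G : Type u) [Group G] : Prop :=
  ∀ (S : Finset G) (ε : ℝ), 0 < ε → ∃ K : Finset G, K.Nonempty ∧
    ∀ g ∈ S, ((symmDiff (K.image (fun x => g * x)) K).card : ℝ) ≤ ε * (K.card : ℝ)

/-- A maximal normal subgroup: maximal among the proper normal subgroups. -/
def IsMaximalNormal {G : Type u} [Group G] (M : Subgroup G) : Prop :=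
  Maximal (fun N : Subgroup G => N.Normal ∧ N ≠ ⊤) M

/-! Soficity is local: it is equivalent to `HasSoficApprox`, which only asks for almost
multiplicative maps on finite sets with separation 1/2. Tensor powers produce this uniform gap, and
an ultraproduct recovers the embedding. Hence a group whose finitely generated subgroups are all
sofic is sofic, so a minimal non-sofic group is finitely generated. Zorn's lemma then gives maximal
subgroups and maximal normal subgroups.

Extensions of sofic groups by amenable quotients are sofic (`HasSoficApprox.of_amenable_quotient`),
which excludes nontrivial amenable quotients. For perfectness finite quotients suffice: if the
commutator subgroup were proper, it would lie in a maximal subgroup, which is normal with abelian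
simple, hence finite, quotient. -/

open Filter Topology

/-! ### Hamming distance and amplification by tensor powers -/

section PermDist

open Classical in
/-- The normalized Hamming distance between permutations of an arbitrary finite type. -/
noncomputable def permDist {X : Type*} [Fintype X] (σ τ : Equiv.Perm X) : ℝ :=
  ((Finset.univ.filter fun x => σ x ≠ τ x).card : ℝ) / Fintype.card X

/-- The diagonal action of a permutation on `k`-tuples. -/
def tensorPow {X : Type*} (k : ℕ) (σ : Equiv.Perm X) : Equiv.Perm (Fin k → X) :=
  Equiv.piCongrRight fun _ => σ

theorem tensorPow_mul {X : Type*} (k : ℕ) (σ τ : Equiv.Perm X) :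
    tensorPow k (σ * τ) = tensorPow k σ * tensorPow k τ := rfl

theorem tensorPow_one {X : Type*} (k : ℕ) : tensorPow k (1 : Equiv.Perm X) = 1 := rfl

variable {X Y : Type*} [Fintype X] [Fintype Y]

theorem normHammingDist_eq_permDist {n : ℕ} (σ τ : Equiv.Perm (Fin n)) :
    normHammingDist σ τ = permDist σ τ := by
  classical
  unfold normHammingDist permDist hammingDist
  rw [Fintype.card_fin]
  congr!

theorem permDist_permCongr (e : X ≃ Y) (σ τ : Equiv.Perm X) :
    permDist (e.permCongr σ) (e.permCongr τ) = permDist σ τ := by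
  classical
  unfold permDist
  rw [Fintype.card_congr e]
  congr 2
  refine (Finset.card_bij (fun x _ => e x) ?_ ?_ ?_).symm
  · intro x hx
    simpa using hx
  · intro x _ y _ h
    exact e.injective h
  · intro y hy
    exact ⟨e.symm y, by simpa using hy, by simp⟩

open Classical in
theorem card_filter_ne_eq_permDist_mul [Nonempty X] (σ τ : Equiv.Perm X) :
    ((Finset.univ.filter fun x => σ x ≠ τ x).card : ℝ) = permDist σ τ * Fintype.card X := by
  unfold permDist
  rw [div_mul_cancel₀ _ (by exact_mod_cast Fintype.card_ne_zero)]

theorem permDist_nonneg (σ τ : Equiv.Perm X) : 0 ≤ permDist σ τ := by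
  unfold permDist
  positivity

theorem permDist_le_one (σ τ : Equiv.Perm X) : permDist σ τ ≤ 1 := by
  classical
  unfold permDist
  refine div_le_one_of_le₀ ?_ (by positivity)
  exact_mod_cast Finset.card_le_univ _

open Classical in
theorem one_sub_permDist [Nonempty X] (σ τ : Equiv.Perm X) :
    1 - permDist σ τ =
      ((Finset.univ.filter fun x => σ x = τ x).card : ℝ) / Fintype.card X := by
  have hX : (Fintype.card X : ℝ) ≠ 0 := by exact_mod_cast Fintype.card_ne_zero
  have h := Finset.card_filter_add_card_filter_not (s := (Finset.univ : Finset X))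
    (fun x => σ x = τ x)
  rw [Finset.card_univ] at h
  unfold permDist
  rw [← h, eq_div_iff (by rw [h]; exact hX), sub_mul, div_mul_cancel₀ _ (by rw [h]; exact hX)]
  push_cast
  ring

/-- Two tensor powers agree on a tuple exactly when the permutations agree at every coordinate, so
proportions of agreement are raised to the power `k`. -/
theorem permDist_tensorPow [Nonempty X] (k : ℕ) (σ τ : Equiv.Perm X) :
    permDist (tensorPow k σ) (tensorPow k τ) = 1 - (1 - permDist σ τ) ^ k := by
  classical
  rw [eq_sub_iff_add_eq, ← eq_sub_iff_add_eq', one_sub_permDist, one_sub_permDist, div_pow]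
  congr 1
  · rw [← Nat.cast_pow, ← Fintype.card_piFinset_const]
    congr 2
    ext x
    simp [tensorPow, funext_iff]
  · simp

theorem permDist_tensorPow_le [Nonempty X] (k : ℕ) (σ τ : Equiv.Perm X) :
    permDist (tensorPow k σ) (tensorPow k τ) ≤ k * permDist σ τ := by
  rw [permDist_tensorPow]
  have h := one_add_mul_le_pow (a := -permDist σ τ) (by linarith [permDist_le_one σ τ]) k
  rw [← sub_eq_add_neg] at h
  linarith

theorem le_permDist_tensorPow [Nonempty X] {k : ℕ} {δ : ℝ} (hδ : (1 - δ) ^ k ≤ 1 / 2)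
    {σ τ : Equiv.Perm X} (h : δ ≤ permDist σ τ) :
    1 / 2 ≤ permDist (tensorPow k σ) (tensorPow k τ) := by
  rw [permDist_tensorPow]
  have : (1 - permDist σ τ) ^ k ≤ (1 - δ) ^ k :=
    pow_le_pow_left₀ (by linarith [permDist_le_one σ τ]) (by linarith) k
  linarith

end PermDist

/-! ### Local characterization of soficity -/

section SoficApprox

/-- Every finite subset of `G` has arbitrarily multiplicative maps to finite symmetric groups
that move at least half of the points at each nontrivial element of the subset. -/
def HasSoficApprox (G : Type*) [Group G] : Prop :=
  ∀ (F : Finset G) (ε : ℝ), 0 < ε → ∃ (n : ℕ) (φ : G → Equiv.Perm (Fin n)), 0 < n ∧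
    (∀ g ∈ F, ∀ h ∈ F, permDist (φ (g * h)) (φ g * φ h) ≤ ε) ∧
    ∀ g ∈ F, g ≠ 1 → 1 / 2 ≤ permDist (φ g) 1

theorem exists_fin_approx {G X : Type*} [Group G] [Fintype X] [Nonempty X] {F : Finset G} {ε : ℝ}
    (φ : G → Equiv.Perm X)
    (hmul : ∀ g ∈ F, ∀ h ∈ F, permDist (φ (g * h)) (φ g * φ h) ≤ ε)
    (hne : ∀ g ∈ F, g ≠ 1 → 1 / 2 ≤ permDist (φ g) 1) :
    ∃ (n : ℕ) (φ : G → Equiv.Perm (Fin n)), 0 < n ∧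
      (∀ g ∈ F, ∀ h ∈ F, permDist (φ (g * h)) (φ g * φ h) ≤ ε) ∧
      ∀ g ∈ F, g ≠ 1 → 1 / 2 ≤ permDist (φ g) 1 := by
  let e := Fintype.equivFin X
  refine ⟨Fintype.card X, fun g => e.permCongr (φ g), Fintype.card_pos, ?_, ?_⟩
  · intro g hg h hh
    have : e.permCongr (φ g) * e.permCongr (φ h) = e.permCongr (φ g * φ h) := by
      ext x
      simp
    rw [this, permDist_permCongr]
    exact hmul g hg h hh
  · intro g hg hg1
    have : (1 : Equiv.Perm (Fin (Fintype.card X))) = e.permCongr 1 := by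
      ext x
      simp
    rw [this, permDist_permCongr]
    exact hne g hg hg1

theorem mem_ultraNull {A : Type u} {U : Ultrafilter A} {n : A → ℕ}
    {σ : (a : A) → Equiv.Perm (Fin (n a))} :
    σ ∈ ultraNull U n ↔ Tendsto (fun a => permDist (σ a) 1) U (𝓝 0) := by
  simp only [← normHammingDist_eq_permDist]
  rfl

theorem eventually_permDist_le {A : Type u} {U : Ultrafilter A} {n : A → ℕ}
    {σ τ : (a : A) → Equiv.Perm (Fin (n a))}
    (h : (σ : MetricUltraproduct U n) = (τ : MetricUltraproduct U n)) {ε : ℝ} (hε : 0 < ε) :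
    ∀ᶠ a in U, permDist (σ a) (τ a) ≤ ε := by
  rw [QuotientGroup.eq, mem_ultraNull] at h
  filter_upwards [h.eventually (gt_mem_nhds hε)] with a ha
  rw [← normHammingDist_eq_permDist] at ha ⊢
  rw [← normHammingDist_mul_left (σ a)⁻¹, normHammingDist_comm]
  simpa using ha.le

theorem exists_eventually_le_permDist {A : Type u} {U : Ultrafilter A} {n : A → ℕ}
    {σ : (a : A) → Equiv.Perm (Fin (n a))} (h : (σ : MetricUltraproduct U n) ≠ 1) :
    ∃ δ : ℝ, 0 < δ ∧ ∀ᶠ a in U, δ ≤ permDist (σ a) 1 := by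
  by_contra! hcon
  refine h ((QuotientGroup.eq_one_iff _).2 (mem_ultraNull.2 ?_))
  refine Metric.tendsto_nhds.2 fun ε hε => ?_
  filter_upwards [hcon ε hε] with a ha
  simpa [abs_of_nonneg (permDist_nonneg _ _)] using ha

/-- Injectivity gives each nontrivial element its own gap. The least gap over `F` fixes a power `k`
that amplifies it to 1/2, while errors grow at most by the factor `k`. -/
theorem IsSofic.hasSoficApprox {G : Type u} [Group G] (hG : IsSofic G) : HasSoficApprox G := by
  classical
  obtain ⟨A, U, n, f, hf⟩ := hG
  intro F ε hε
  choose σ hσ using fun g => QuotientGroup.mk_surjective (f g)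
  by_cases hF : ∀ g ∈ F, g = 1
  · refine ⟨1, fun _ => 1, one_pos, ?_, fun g hg h => absurd (hF g hg) h⟩
    intro g _ h _
    simpa [permDist] using hε.le
  push Not at hF
  obtain ⟨g₀, hg₀, hg₀1⟩ := hF
  have hδ : ∀ g : G, ∃ δ : ℝ, 0 < δ ∧ (g ≠ 1 → ∀ᶠ a in U, δ ≤ permDist (σ g a) 1) := by
    intro g
    by_cases hg : g = 1
    · exact ⟨1, one_pos, fun h => absurd hg h⟩
    · obtain ⟨δ, h0, h⟩ := exists_eventually_le_permDist (U := U) (σ := σ g) (by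
        rw [hσ]
        exact fun h => hg (hf (by simpa using h)))
      exact ⟨δ, h0, fun _ => h⟩
  choose δ hδ0 hδ using hδ
  obtain ⟨g₁, -, hg₁⟩ := F.exists_min_image δ ⟨g₀, hg₀⟩
  set d := min (δ g₁) 1 with hd
  have hd0 : 0 < d := lt_min (hδ0 _) one_pos
  have hdF : ∀ g ∈ F, d ≤ δ g := fun g hg => (min_le_left _ _).trans (hg₁ g hg)
  obtain ⟨k, hk⟩ := exists_pow_lt_of_lt_one (show (0 : ℝ) < 1 / 2 by norm_num)
    (show 1 - d < 1 by linarith)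
  have hmul : ∀ᶠ a in U, ∀ g ∈ F, ∀ h ∈ F,
      permDist (σ (g * h) a) (σ g a * σ h a) ≤ ε / (k + 1) := by
    refine (Finset.eventually_all F).2 fun g _ => (Finset.eventually_all F).2 fun h _ => ?_
    refine eventually_permDist_le (U := U) (σ := σ (g * h)) (τ := σ g * σ h) ?_ (by positivity)
    rw [QuotientGroup.mk_mul, hσ, hσ, hσ, map_mul]
  have hne : ∀ᶠ a in U, ∀ g ∈ F, g ≠ 1 → d ≤ permDist (σ g a) 1 := by
    refine (Finset.eventually_all F).2 fun g hg => ?_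
    by_cases hg1 : g = 1
    · exact Eventually.of_forall fun _ h => absurd hg1 h
    · filter_upwards [hδ g hg1] with a ha _ using (hdF g hg).trans ha
  obtain ⟨a, hmula, hnea⟩ := (hmul.and hne).exists
  -- The degree may be 0, but then all distances vanish, against the gap at `g₀`.
  have hn : Nonempty (Fin (n a)) := by
    by_contra hempty
    have := hnea g₀ hg₀ hg₀1
    rw [not_nonempty_iff] at hempty
    simp [permDist] at this
    linarith
  refine exists_fin_approx (fun g => tensorPow k (σ g a)) ?_ ?_
  · intro g hg h hh
    rw [← tensorPow_mul]
    refine (permDist_tensorPow_le _ _ _).trans ?_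
    have h1 := hmula g hg h hh
    rw [le_div_iff₀ (by positivity)] at h1
    nlinarith [permDist_nonneg (σ (g * h) a) (σ g a * σ h a)]
  · intro g hg hg1
    rw [← tensorPow_one]
    exact le_permDist_tensorPow hk.le (hnea g hg hg1)

/-- Index by pairs (finite set, precision): along an ultrafilter finer than `atTop` every element
eventually lies in the finite set and the error tends to 0, while the gap 1/2 persists. -/
theorem HasSoficApprox.isSofic {G : Type u} [Group G] (hG : HasSoficApprox G) : IsSofic G := by
  classical
  choose n φ _ hmul hne using fun a : Finset G × ℕ =>
    hG a.1 (1 / ((a.2 : ℝ) + 1)) (by positivity)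
  let U : Ultrafilter (Finset G × ℕ) := Ultrafilter.of atTop
  have hU : (U : Filter (Finset G × ℕ)) ≤ atTop := Ultrafilter.of_le _
  have hmem : ∀ g : G, ∀ᶠ a : Finset G × ℕ in U, g ∈ a.1 := fun g =>
    hU ((eventually_ge_atTop (({g}, 0) : Finset G × ℕ)).mono fun a ha => ha.1 (by simp))
  have hlim : Tendsto (fun a : Finset G × ℕ => 1 / ((a.2 : ℝ) + 1)) U (𝓝 0) := by
    have h2 : Tendsto (Prod.snd : Finset G × ℕ → ℕ) atTop atTop := by
      rw [← prod_atTop_atTop_eq]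
      exact tendsto_snd
    exact (tendsto_one_div_add_atTop_nhds_zero_nat.comp h2).mono_left hU
  let f : G →* MetricUltraproduct U n :=
    MonoidHom.mk' (fun g => QuotientGroup.mk fun a => φ a g) (by
      intro g h
      rw [← QuotientGroup.mk_mul, QuotientGroup.eq, mem_ultraNull]
      refine squeeze_zero' (Eventually.of_forall fun a => permDist_nonneg _ _) ?_ hlim
      filter_upwards [hmem g, hmem h] with a hg hh
      refine le_trans (le_of_eq ?_) (hmul a g hg h hh)
      rw [← normHammingDist_eq_permDist, ← normHammingDist_eq_permDist,
        ← normHammingDist_mul_left (φ a (g * h)), normHammingDist_comm]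
      simp)
  refine ⟨Finset G × ℕ, U, n, f, (injective_iff_map_eq_one f).2 fun g hg => ?_⟩
  by_contra hg1
  have h0 : Tendsto (fun a => permDist (φ a g) 1) U (𝓝 0) :=
    mem_ultraNull.1 ((QuotientGroup.eq_one_iff (N := ultraNull U n) (fun a => φ a g)).1 hg)
  obtain ⟨a, ha, hga⟩ := ((h0.eventually (gt_mem_nhds (show (0 : ℝ) < 1 / 2 by norm_num))).and
    (hmem g)).exists
  exact absurd (hne a g hga hg1) (not_le.2 ha)

theorem isSofic_of_forall_fg {G : Type u} [Group G]
    (h : ∀ H : Subgroup G, H.FG → IsSofic H) : IsSofic G := by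
  classical
  refine HasSoficApprox.isSofic fun F ε hε => ?_
  let H := Subgroup.closure (F : Set G)
  have hF : ∀ g ∈ F, g ∈ H := fun g hg => Subgroup.subset_closure hg
  obtain ⟨n, φ, hn, hmul, hne⟩ := (h H ⟨F, rfl⟩).hasSoficApprox (F.subtype (· ∈ H)) ε hε
  refine ⟨n, fun g => if hg : g ∈ H then φ ⟨g, hg⟩ else 1, hn, ?_, ?_⟩
  · intro g hg k hk
    simp only [dif_pos (hF g hg), dif_pos (hF k hk), dif_pos (mul_mem (hF g hg) (hF k hk))]
    exact hmul ⟨g, hF g hg⟩ (by simpa using hg) ⟨k, hF k hk⟩ (by simpa using hk)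
  · intro g hg hg1
    simp only [dif_pos (hF g hg)]
    exact hne ⟨g, hF g hg⟩ (by simpa using hg) (by simpa using hg1)

end SoficApprox

/-! ### Extensions by amenable groups -/

section AmenableExtension

theorem exists_perm_eqOn {Y : Type*} [Finite Y] (p : Y → Prop) (f : Y → Y)
    (hf : Set.InjOn f {y | p y}) : ∃ σ : Equiv.Perm Y, ∀ y, p y → σ y = f y := by
  classical
  have := Fintype.ofFinite Y
  let e : {y // p y} ≃ {y // ∃ x, p x ∧ f x = y} :=
    Equiv.ofBijective (fun y => ⟨f y, y, y.2, rfl⟩)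
      ⟨fun x y h => Subtype.ext (hf x.2 y.2 (congrArg Subtype.val h)),
        fun ⟨_, x, hx, h⟩ => ⟨⟨x, hx⟩, Subtype.ext h⟩⟩
  exact ⟨e.extendSubtype, fun y hy => e.extendSubtype_apply_of_mem y hy⟩

section Product

variable {κ X : Type*} [Fintype κ] [Fintype X]

open Classical in
theorem permDist_prod (σ τ : Equiv.Perm (κ × X)) :
    permDist σ τ = (∑ q, ((Finset.univ.filter fun x => σ (q, x) ≠ τ (q, x)).card : ℝ)) /
      (Fintype.card κ * Fintype.card X) := by
  unfold permDist
  rw [Finset.card_filter, Fintype.sum_prod_type, Fintype.card_prod]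
  simp [Finset.card_filter]

open Classical in
theorem permDist_prod_le [Nonempty κ] [Nonempty X] (σ τ : Equiv.Perm (κ × X)) (B : Finset κ)
    {δ : ℝ} (hδ : 0 ≤ δ)
    (h : ∀ q ∉ B, ((Finset.univ.filter fun x => σ (q, x) ≠ τ (q, x)).card : ℝ) ≤
      δ * Fintype.card X) :
    permDist σ τ ≤ B.card / Fintype.card κ + δ := by
  have hκ : (0 : ℝ) < Fintype.card κ := by exact_mod_cast Fintype.card_pos
  have hX : (0 : ℝ) < Fintype.card X := by exact_mod_cast Fintype.card_pos
  rw [permDist_prod, div_le_iff₀ (by positivity)]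
  calc _ ≤ ∑ q : κ, ((if q ∈ B then (1 : ℝ) else 0) + δ) * Fintype.card X := by
        refine Finset.sum_le_sum fun q _ => ?_
        split_ifs with hq
        · have : ((Finset.univ.filter fun x => σ (q, x) ≠ τ (q, x)).card : ℝ) ≤
              Fintype.card X := by exact_mod_cast Finset.card_le_univ _
          nlinarith
        · simpa using h q hq
    _ = _ := by
        rw [← Finset.sum_mul, Finset.sum_add_distrib]
        simp
        field_simp

open Classical in
theorem le_permDist_prod [Nonempty κ] [Nonempty X] (σ τ : Equiv.Perm (κ × X)) (B : Finset κ)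
    {δ : ℝ} (hδ : δ ≤ 1)
    (h : ∀ q ∉ B, δ * Fintype.card X ≤
      ((Finset.univ.filter fun x => σ (q, x) ≠ τ (q, x)).card : ℝ)) :
    δ - B.card / Fintype.card κ ≤ permDist σ τ := by
  have hκ : (0 : ℝ) < Fintype.card κ := by exact_mod_cast Fintype.card_pos
  have hX : (0 : ℝ) < Fintype.card X := by exact_mod_cast Fintype.card_pos
  rw [permDist_prod, le_div_iff₀ (by positivity)]
  calc _ = ∑ q : κ, (δ - (if q ∈ B then (1 : ℝ) else 0)) * Fintype.card X := by
        rw [← Finset.sum_mul, Finset.sum_sub_distrib]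
        simp
        field_simp
    _ ≤ _ := by
        refine Finset.sum_le_sum fun q _ => ?_
        split_ifs with hq
        · have : (0 : ℝ) ≤ ((Finset.univ.filter fun x => σ (q, x) ≠ τ (q, x)).card : ℝ) := by
            positivity
          nlinarith
        · simpa using h q hq

end Product

open Classical in
theorem card_filter_mul_notMem_le {Q : Type*} [Group Q] (K : Finset Q) (g : Q) :
    (Finset.univ.filter fun q : K => g * (q : Q) ∉ K).card ≤
      (symmDiff (K.image fun x => g * x) K).card := by
  refine Finset.card_le_card_of_injOn (fun q : K => g * (q : Q)) ?_ ?_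
  · intro q hq
    have hq' : g * (q : Q) ∉ K := by simpa using hq
    exact Finset.mem_coe.2 (Finset.mem_symmDiff.2
      (Or.inl ⟨Finset.mem_image_of_mem _ q.2, hq'⟩))
  · intro q _ r _ h
    exact Subtype.ext (mul_left_cancel h)

variable {G : Type u} [Group G] (N : Subgroup G) [N.Normal]

/-- The `N`-valued cocycle attached to the set-theoretic section `Quotient.out` of `G → G ⧸ N`. -/
noncomputable def extensionCocycle (g : G) (q : G ⧸ N) : N :=
  ⟨((g : G ⧸ N) * q).out⁻¹ * g * q.out, by
    rw [← QuotientGroup.eq_one_iff]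
    simp⟩

/-- This identity makes `(q, x) ↦ (g q, c(g, q) x)` an action of `G`, induced from one of `N`. -/
theorem extensionCocycle_mul (g h : G) (q : G ⧸ N) :
    extensionCocycle N (g * h) q =
      extensionCocycle N g ((h : G ⧸ N) * q) * extensionCocycle N h q := by
  ext
  simp [extensionCocycle, mul_assoc]

theorem eq_one_of_extensionCocycle_eq_one {g : G} (hg : g ∈ N) {q : G ⧸ N}
    (h : extensionCocycle N g q = 1) : g = 1 := by
  have hg' : (g : G ⧸ N) = 1 := (QuotientGroup.eq_one_iff g).2 hg
  have h' := congrArg Subtype.val h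
  simp only [extensionCocycle, hg', one_mul, Subgroup.coe_one] at h'
  rw [mul_assoc, inv_mul_eq_one] at h'
  exact (right_eq_mul.1 h')

/-- The induced action restricted to the fibres over `K`; where `g q` leaves `K`, the injective
partial map is completed arbitrarily. -/
theorem exists_twisted_perm {X : Type*} [Finite X] (φ : N → Equiv.Perm X) (K : Finset (G ⧸ N))
    (g : G) : ∃ σ : Equiv.Perm (K × X), ∀ (q : K) (hq : (g : G ⧸ N) * q ∈ K) (x : X),
      σ (q, x) = (⟨(g : G ⧸ N) * q, hq⟩, φ (extensionCocycle N g q) x) := by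
  classical
  obtain ⟨σ, hσ⟩ := exists_perm_eqOn (fun y : K × X => (g : G ⧸ N) * y.1 ∈ K)
    (fun y => if hy : (g : G ⧸ N) * y.1 ∈ K then
      (⟨(g : G ⧸ N) * y.1, hy⟩, φ (extensionCocycle N g y.1) y.2) else y) (by
    rintro ⟨q, x⟩ hq ⟨r, y⟩ hr h
    simp only [Set.mem_ofPred_eq] at hq hr
    simp only [dif_pos hq, dif_pos hr, Prod.mk.injEq, Subtype.mk.injEq, mul_right_inj] at h
    obtain ⟨h1, h2⟩ := h
    obtain rfl : q = r := Subtype.ext h1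
    rw [(φ _).injective h2])
  exact ⟨σ, fun q hq x => by rw [hσ (q, x) hq, dif_pos hq]⟩

/-- Elek–Szabó: an extension of a sofic group by an amenable group is sofic. -/
theorem HasSoficApprox.of_amenable_quotient (hN : HasSoficApprox N)
    (hQ : IsAmenableGroup (G ⧸ N)) : HasSoficApprox G := by
  classical
  intro F ε hε
  -- The multiplicative error has three parts: the fibres that `h` or `g * h` push out of `K`, and
  -- the error of `φ`. The bound 1/2 serves the elements outside `N`.
  set η : ℝ := min (ε / 3) (1 / 2) with hη
  have hη0 : 0 < η := lt_min (by positivity) (by norm_num)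
  have hηε : 3 * η ≤ ε := by linarith [min_le_left (ε / 3) (1 / 2 : ℝ)]
  have hη2 : η ≤ 1 / 2 := min_le_right _ _
  obtain ⟨K, hK, hKF⟩ := hQ ((F ∪ Finset.image₂ (· * ·) F F).image (QuotientGroup.mk : G → G ⧸ N)) η hη0
  obtain ⟨n, φ, hn, hmul, hne⟩ :=
    hN (Finset.image₂ (fun g q => extensionCocycle N g q) F K) η hη0
  have : Nonempty (Fin n) := ⟨⟨0, hn⟩⟩
  have : Nonempty K := hK.to_subtype
  have hK0 : (0 : ℝ) < K.card := by exact_mod_cast hK.card_pos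
  let B : G → Finset K := fun g => Finset.univ.filter fun q => (g : G ⧸ N) * (q : G ⧸ N) ∉ K
  have hB : ∀ g ∈ F ∪ Finset.image₂ (· * ·) F F, ((B g).card : ℝ) / K.card ≤ η := by
    intro g hg
    rw [div_le_iff₀ hK0]
    refine le_trans ?_ (hKF _ (Finset.mem_image_of_mem _ hg))
    refine Nat.cast_le.2 (le_of_eq_of_le ?_ ((card_filter_mul_notMem_le K (g : G ⧸ N)).trans_eq ?_))
    all_goals congr!
  have hBmem : ∀ {g : G} {q : K}, q ∉ B g → (g : G ⧸ N) * (q : G ⧸ N) ∈ K := by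
    intro g q hq
    simpa [B] using hq
  choose ψ hψ using exists_twisted_perm N φ K
  refine exists_fin_approx ψ ?_ ?_
  · intro g hg h hh
    have hBh := hB h (Finset.mem_union_left _ hh)
    have hBgh := hB (g * h) (Finset.mem_union_right _ (Finset.mem_image₂_of_mem hg hh))
    have hBcard : ((B h ∪ B (g * h)).card : ℝ) ≤ (B h).card + (B (g * h)).card := by
      exact_mod_cast Finset.card_union_le _ _
    have key := permDist_prod_le (ψ (g * h)) (ψ g * ψ h) (B h ∪ B (g * h)) hη0.le (by
      intro q hq
      rw [Finset.notMem_union] at hq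
      have hq1 := hBmem hq.1
      have hq2 := hBmem hq.2
      have hq3 : (g : G ⧸ N) * ((h : G ⧸ N) * q) ∈ K := by
        rwa [← mul_assoc, ← QuotientGroup.mk_mul]
      have hm := hmul _ (Finset.mem_image₂_of_mem hg hq1) _ (Finset.mem_image₂_of_mem hh q.2)
      rw [← extensionCocycle_mul] at hm
      refine le_trans ?_ (mul_le_mul_of_nonneg_right hm (Nat.cast_nonneg _))
      rw [← card_filter_ne_eq_permDist_mul]
      refine Nat.cast_le.2 (Finset.card_le_card fun x hx => ?_)
      simp only [Finset.mem_filter, Finset.mem_univ, true_and] at hx ⊢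
      contrapose! hx
      rw [Equiv.Perm.mul_apply, hψ (g * h) q hq2, hψ h q hq1,
        hψ g ⟨(h : G ⧸ N) * q, hq1⟩ hq3, hx]
      simp [mul_assoc])
    rw [Fintype.card_coe] at key
    have := div_le_div_of_nonneg_right hBcard hK0.le
    rw [add_div] at this
    linarith
  · intro g hg hg1
    -- Elements of `N` preserve every fibre and act there through `φ` at a conjugate of `g`; other
    -- elements move every fibre that stays in `K`, hence a proportion at least `1 - η`.
    by_cases hgN : g ∈ N
    · have hg' : (g : G ⧸ N) = 1 := (QuotientGroup.eq_one_iff g).2 hgN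
      have key := le_permDist_prod (ψ g) 1 ∅ (δ := 1 / 2) (by norm_num) (by
        intro q _
        have hq : (g : G ⧸ N) * (q : G ⧸ N) ∈ K := by
          rw [hg', one_mul]
          exact q.2
        have hm := hne _ (Finset.mem_image₂_of_mem hg q.2)
          fun h => hg1 (eq_one_of_extensionCocycle_eq_one N hgN h)
        refine (mul_le_mul_of_nonneg_right hm (Nat.cast_nonneg _)).trans ?_
        rw [← card_filter_ne_eq_permDist_mul]
        refine Nat.cast_le.2 (Finset.card_le_card fun x hx => ?_)
        simp only [Finset.mem_filter, Finset.mem_univ, true_and] at hx ⊢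
        rw [hψ g q hq]
        exact fun h => hx (congrArg Prod.snd h))
      simpa using key
    · have hg' : (g : G ⧸ N) ≠ 1 := fun h => hgN ((QuotientGroup.eq_one_iff g).1 h)
      have key := le_permDist_prod (ψ g) 1 (B g) le_rfl (by
        intro q hq
        rw [one_mul]
        refine Nat.cast_le.2 ?_
        rw [← Finset.card_univ]
        refine Finset.card_le_card fun x _ => ?_
        simp only [Finset.mem_filter, Finset.mem_univ, true_and]
        rw [hψ g q (hBmem hq)]
        intro h
        have h1 := congrArg (fun y => ((Prod.fst y : K) : G ⧸ N)) h
        exact hg' (by simpa using h1))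
      rw [Fintype.card_coe] at key
      linarith [hB g (Finset.mem_union_left _ hg)]

end AmenableExtension

/-! ### Maximal subgroups of finitely generated groups -/

section Groups

theorem isSofic_of_subsingleton (G : Type u) [Group G] [Subsingleton G] : IsSofic G :=
  HasSoficApprox.isSofic fun _ ε hε =>
    ⟨1, fun _ => 1, one_pos, fun _ _ _ _ => by simpa [permDist] using hε.le,
      fun g _ hg => absurd (Subsingleton.elim g 1) hg⟩

theorem isAmenableGroup_of_finite (G : Type u) [Group G] [Finite G] : IsAmenableGroup G := by
  classical
  have := Fintype.ofFinite G
  intro S ε hε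
  refine ⟨Finset.univ, Finset.univ_nonempty, fun g _ => ?_⟩
  rw [Finset.image_univ_of_surjective (Group.mulLeft_bijective g).2, symmDiff_self]
  simp only [Finset.bot_eq_empty, Finset.card_empty, Nat.cast_zero]
  positivity

variable {G : Type u} [Group G]

/-- By directedness, finitely many generators already lie in a single member of `C`. -/
theorem Subgroup.exists_eq_top_of_sSup_eq_top [Group.FG G] {C : Set (Subgroup G)}
    (hne : C.Nonempty) (hC : DirectedOn (· ≤ ·) C) (h : sSup C = ⊤) : ⊤ ∈ C := by
  classical
  obtain ⟨S, hS⟩ := Group.fg_def.1 (inferInstance : Group.FG G)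
  have hmem : ∀ s ∈ S, ∃ H ∈ C, s ∈ H := fun s _ =>
    (Subgroup.mem_sSup_of_directedOn hne hC).1 (h ▸ Subgroup.mem_top s)
  have hsub : ∀ T : Finset G, T ⊆ S → ∃ H ∈ C, (T : Set G) ⊆ H := by
    intro T
    induction T using Finset.induction_on with
    | empty => exact fun _ => ⟨hne.some, hne.some_mem, by simp⟩
    | insert s T _ ih =>
      intro hT
      obtain ⟨H, hH, hTH⟩ := ih ((Finset.subset_insert _ _).trans hT)
      obtain ⟨H', hH', hs⟩ := hmem s (hT (Finset.mem_insert_self _ _))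
      obtain ⟨L, hL, hHL, hHL'⟩ := hC H hH H' hH'
      refine ⟨L, hL, ?_⟩
      rw [Finset.coe_insert]
      exact Set.insert_subset (hHL' hs) (hTH.trans hHL)
  obtain ⟨H, hH, hSH⟩ := hsub S subset_rfl
  have : H = ⊤ := by
    rw [eq_top_iff, ← hS]
    exact (Subgroup.closure_le H).2 hSH
  exact this ▸ hH

theorem Subgroup.isCoatomic_of_fg [Group.FG G] : IsCoatomic (Subgroup G) := by
  refine CompleteLattice.coatomic_of_top_compact
    ((CompleteLattice.isCompactElement_iff_le_of_directed_sSup_le _ _).2 ?_)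
  exact fun C hne hC h =>
    ⟨⊤, Subgroup.exists_eq_top_of_sSup_eq_top hne hC (top_le_iff.1 h), le_rfl⟩

theorem exists_isMaximalNormal [Group.FG G] [Nontrivial G] :
    ∃ M : Subgroup G, IsMaximalNormal M := by
  obtain ⟨M, -, hM⟩ := zorn_le_nonempty₀ {N : Subgroup G | N.Normal ∧ N ≠ ⊤} (by
    intro C hCs hC H hH
    exact ⟨sSup C, ⟨Subgroup.sSup_normal C fun L hL => (hCs hL).1, fun h =>
      (hCs (Subgroup.exists_eq_top_of_sSup_eq_top ⟨H, hH⟩ hC.directedOn h)).2 rfl⟩,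
      fun L hL => le_sSup hL⟩) ⊥ ⟨inferInstance, bot_ne_top⟩
  exact ⟨M, hM⟩

/-- By correspondence the quotient is simple; being abelian, it has prime order. -/
theorem finite_quotient_of_isCoatom {M : Subgroup G} [M.Normal] (hM : IsCoatom M)
    (hcomm : commutator G ≤ M) : Finite (G ⧸ M) := by
  let _ : CommGroup (G ⧸ M) :=
    { (inferInstance : Group (G ⧸ M)) with
      mul_comm := (Subgroup.Normal.quotient_commutative_iff_commutator_le.2 hcomm).is_comm.comm }
  have : Nontrivial (G ⧸ M) := QuotientGroup.nontrivial_iff.2 hM.1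
  have : IsSimpleGroup (G ⧸ M) := by
    refine ⟨fun H _ => ?_⟩
    have hle : M ≤ H.comap (QuotientGroup.mk' M) := by
      intro x hx
      have : QuotientGroup.mk' M x = 1 := (QuotientGroup.eq_one_iff x).2 hx
      rw [Subgroup.mem_comap, this]
      exact H.one_mem
    have hsurj := QuotientGroup.mk'_surjective M
    rcases hle.eq_or_lt with h | h
    · left
      rw [← Subgroup.map_comap_eq_self_of_surjective hsurj H, ← h]
      exact QuotientGroup.map_mk'_self M
    · right
      rw [← Subgroup.map_comap_eq_self_of_surjective hsurj H, hM.2 _ h]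
      exact Subgroup.map_top_of_surjective _ hsurj
  exact Nat.finite_of_card_ne_zero (CommGroup.is_simple_iff_prime_card.1 this).ne_zero

end Groups

/-! ### Consequences for minimal non-sofic groups -/

namespace IsMinimalNonSofic

variable {G : Type u} [Group G]

theorem nontrivial (hG : IsMinimalNonSofic G) : Nontrivial G := by
  by_contra h
  rw [not_nontrivial_iff_subsingleton] at h
  exact hG.not_isSofic (isSofic_of_subsingleton G)

theorem group_fg (hG : IsMinimalNonSofic G) : Group.FG G := by
  by_contra h
  refine hG.not_isSofic (isSofic_of_forall_fg fun H hH => hG.isSofic_of_ne_top H ?_)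
  rintro rfl
  exact h (Group.fg_def.2 hH)

theorem not_isAmenableGroup_quotient (hG : IsMinimalNonSofic G) (N : Subgroup G) [N.Normal]
    (hN : Nontrivial (G ⧸ N)) : ¬ IsAmenableGroup (G ⧸ N) := fun h =>
  hG.not_isSofic (HasSoficApprox.of_amenable_quotient N
    (hG.isSofic_of_ne_top N (QuotientGroup.nontrivial_iff.1 hN)).hasSoficApprox h).isSofic

theorem isPerfect (hG : IsMinimalNonSofic G) : Group.IsPerfect G := by
  have := hG.group_fg
  have := Subgroup.isCoatomic_of_fg (G := G)
  rcases eq_top_or_exists_le_coatom (commutator G) with h | ⟨M, hM, hle⟩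
  · exact ⟨h⟩
  · have : M.Normal := Subgroup.Normal.of_commutator_le _ hle
    have := finite_quotient_of_isCoatom hM hle
    exact absurd (isAmenableGroup_of_finite (G ⧸ M))
      (hG.not_isAmenableGroup_quotient M (QuotientGroup.nontrivial_iff.2 hM.1))

end IsMinimalNonSofic

theorem proposition2p4 {G : Type u} [Group G] (hG : IsMinimalNonSofic G) :
    (Group.FG G ∧ ∃ M : Subgroup G, IsCoatom M) ∧
    ((∀ (N : Subgroup G) [N.Normal], Nontrivial (G ⧸ N) → ¬ IsAmenableGroup (G ⧸ N)) ∧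
      Group.IsPerfect G) ∧
    ∃ M : Subgroup G, IsMaximalNormal M := by
  have := hG.nontrivial
  have hfg := hG.group_fg
  have := Subgroup.isCoatomic_of_fg (G := G)
  obtain ⟨M, hM, -⟩ := (eq_top_or_exists_le_coatom (⊥ : Subgroup G)).resolve_left bot_ne_top
  exact ⟨⟨hfg, M, hM⟩, ⟨fun N _ => hG.not_isAmenableGroup_quotient N, hG.isPerfect⟩,
    exists_isMaximalNormal⟩
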